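/- Let $(X,d,S)$ be a computable metric space: a metric space $(X,d)$ with a dense sequence $S=(s_i)_{i\in\mathbb N}$ of ideal points such that the distances $d(s_i,s_j)$ are computable reals uniformly in $i,j$ (one algorithm outputs, on input $i,j,n$, a rational within $2^{-n}$ of $d(s_i,s_j)$). Ideal balls are the balls $B(s_i,q)$ with $q\in\mathbb Q_{>0}$. Sets $U_i\subseteq X$ are uniformly constructive open if one (partial) algorithm enumerates, on input $i$, ideal balls whose union is $U_i$; sets $D_i$ are uniformly constructive $G_\delta$-sets if $D_i=\bigcap_n V_{i,n}$ with $V_{i,n}$ constructive open uniformly in $i,n$. A point $x\in X$ is computable if some algorithm enumerates ideal points $x_n$ with $d(x_n,x)\le 2^{-n}$ for all $n$. Let $\mu$ be a computable Borel probability measure on $X$: some algorithm enumerates probability measures $\mu_n$, each a finite combination of Dirac masses at ideal points with rational weights, at Prokhorov distance at most $2^{-n}$ from $\mu$. Measurable functions $f_i:X\to\mathbb R$ are uniformly $\delta$ a.e.-computable if there are uniformly constructive $G_\delta$-sets $D_i$ with $\mu(D_i)=1$ and, for every open interval $I$ with rational centre and positive rational radius, constructive open sets $U_{i,I}$, uniformly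 in $i$ and $I$, with $f_i^{-1}(I)\cap D_i=U_{i,I}\cap D_i$. The functions $f_n$ converge effectively almost surely to $f$ if there is a computable function $N:\mathbb Q_{>0}\times\mathbb Q_{>0}\to\mathbb N$ such that $\mu\{x:\sup_{k\ge n}|f_k(x)-f(x)|\ge\varepsilon\}<\delta$ for all $\varepsilon,\delta$ and all $n\ge N(\varepsilon,\delta)$. A constructive Borel–Cantelli set is a set $\bigcup_k\bigcap_{n\ge k}U_n$, where the $U_n$ are uniformly constructive open sets such that $\mu(X\setminus U_n)$ is effectively summable, i.e. there is an algorithm $A:\mathbb Q_{>0}\to\mathbb N$ with $\sum_{n\ge A(\varepsilon)}\mu(X\setminus U_n)\le\varepsilon$ for all $\varepsilon$. Theorem. Let $f_n$ $(n\in\mathbb N)$ and $f$ be uniformly $\delta$ a.e.-computable real random variables on $(X,\mu)$. If $f_n$ converges effectively almost surely to $f$, then the set $\{x:f_n(x)\to f(x)\}$ contains a constructive Borel–Cantelli set. If moreover $(X,d)$ is complete, then the computable points $x\in\mathrm{Supp}(\mu)$ with $f_n(x)\to f(x)$ form a dense subset of $\mathrm{Supp}(\mu)$. -/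

import Mathlib

open MeasureTheory Filter Topology
open scoped ENNReal

namespace ConstructiveBC

/-- An effective numbering of the rational numbers: the number `⟨a, ⟨b, c⟩⟩` (Cantor pairing)
denotes `(a - b) / (c + 1)`. Every rational is listed. -/
def rat (n : ℕ) : ℚ :=
  ((n.unpair.1 : ℚ) - (n.unpair.2.unpair.1 : ℚ)) / ((n.unpair.2.unpair.2 : ℚ) + 1)

/-- An effective numbering of the positive rational numbers: the number `⟨a, b⟩` denotes
`(a + 1) / (b + 1)`. -/
def posRat (n : ℕ) : ℚ :=
  ((n.unpair.1 : ℚ) + 1) / ((n.unpair.2 : ℚ) + 1)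

/-- A family of real numbers `x i` that is computable uniformly in `i`: one algorithm outputs,
on input `(i, n)`, (the number of) a rational at distance at most `2⁻ⁿ` of `x i`. -/
def UniformlyComputableReals {ι : Type*} [Primcodable ι] (x : ι → ℝ) : Prop :=
  ∃ A : ι → ℕ → ℕ, Computable₂ A ∧ ∀ i n, |((rat (A i n) : ℚ) : ℝ) - x i| ≤ (2⁻¹ : ℝ) ^ n

/-- A computable metric space: a metric space with a dense sequence of ideal points whose mutual
distances are uniformly computable. (The numbering of the ideal points need not be injective.) -/
class ComputableMetricSpace (X : Type*) [MetricSpace X] where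
  /-- the sequence of ideal points -/
  ideal : ℕ → X
  dense_ideal : DenseRange ideal
  computable_dist :
    UniformlyComputableReals (fun p : ℕ × ℕ => dist (ideal p.1) (ideal p.2))

section Real

/-- The number of `|rat i - rat j|`. -/
def ratDist (i j : ℕ) : ℕ :=
  let u := i.unpair.1 * (j.unpair.2.unpair.2 + 1) + j.unpair.2.unpair.1 * (i.unpair.2.unpair.2 + 1)
  let v := i.unpair.2.unpair.1 * (j.unpair.2.unpair.2 + 1) + j.unpair.1 * (i.unpair.2.unpair.2 + 1)
  Nat.pair ((u - v) + (v - u)) (Nat.pair 0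
    (i.unpair.2.unpair.2 * j.unpair.2.unpair.2 + i.unpair.2.unpair.2 + j.unpair.2.unpair.2))

theorem rat_ratDist (i j : ℕ) : rat (ratDist i j) = |rat i - rat j| := by
  unfold rat ratDist
  simp only [Nat.unpair_pair]
  generalize i.unpair.1 = a
  generalize i.unpair.2.unpair.1 = b
  generalize i.unpair.2.unpair.2 = c
  generalize j.unpair.1 = a'
  generalize j.unpair.2.unpair.1 = b'
  generalize j.unpair.2.unpair.2 = c'
  have hc : (0 : ℚ) < (c : ℚ) + 1 := by positivity
  have hc' : (0 : ℚ) < (c' : ℚ) + 1 := by positivity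
  rw [div_sub_div _ _ hc.ne' hc'.ne', abs_div, abs_of_pos (mul_pos hc hc')]
  congr 1
  · generalize hu : a * (c' + 1) + b' * (c + 1) = u
    generalize hv : b * (c' + 1) + a' * (c + 1) = v
    have e : ((a : ℚ) - b) * ((c' : ℚ) + 1) - ((c : ℚ) + 1) * ((a' : ℚ) - b') = (u : ℚ) - v := by
      rw [← hu, ← hv]; push_cast; ring
    rw [e]
    rcases le_total u v with h | h
    · have h' : (u : ℚ) ≤ v := by exact_mod_cast h
      rw [Nat.sub_eq_zero_of_le h, abs_of_nonpos (by linarith)]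
      push_cast [Nat.cast_sub h]; ring
    · have h' : (v : ℚ) ≤ u := by exact_mod_cast h
      rw [Nat.sub_eq_zero_of_le h, abs_of_nonneg (by linarith)]
      push_cast [Nat.cast_sub h]; ring
  · push_cast; ring

theorem primrec_ratDist : Primrec₂ ratDist := by
  have one : Primrec fun n : ℕ => n.unpair.1 := Primrec.fst.comp Primrec.unpair
  have two : Primrec fun n : ℕ => n.unpair.2 := Primrec.snd.comp Primrec.unpair
  have i : Primrec fun p : ℕ × ℕ => p.1 := Primrec.fst
  have j : Primrec fun p : ℕ × ℕ => p.2 := Primrec.snd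
  have a := one.comp i
  have b := one.comp (two.comp i)
  have c := two.comp (two.comp i)
  have a' := one.comp j
  have b' := one.comp (two.comp j)
  have c' := two.comp (two.comp j)
  have u := Primrec.nat_add.comp (Primrec.nat_mul.comp a (Primrec.succ.comp c'))
    (Primrec.nat_mul.comp b' (Primrec.succ.comp c))
  have v := Primrec.nat_add.comp (Primrec.nat_mul.comp b (Primrec.succ.comp c'))
    (Primrec.nat_mul.comp a' (Primrec.succ.comp c))
  exact Primrec₂.natPair.comp
    (Primrec.nat_add.comp (Primrec.nat_sub.comp u v) (Primrec.nat_sub.comp v u))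
    (Primrec₂.natPair.comp (Primrec.const 0)
      (Primrec.nat_add.comp (Primrec.nat_add.comp (Primrec.nat_mul.comp c c') c) c'))

theorem rat_surjective : Function.Surjective rat := by
  intro q
  refine ⟨Nat.pair q.num.toNat (Nat.pair (-q.num).toNat (q.den - 1)), ?_⟩
  have h1 : ((q.num.toNat : ℚ) - ((-q.num).toNat : ℚ)) = q.num := by
    exact_mod_cast congrArg (Int.cast : ℤ → ℚ) (Int.toNat_sub_toNat_neg q.num)
  have h2 : (((q.den - 1 : ℕ) : ℚ) + 1) = q.den := by
    exact_mod_cast congrArg (Nat.cast : ℕ → ℚ) (Nat.succ_pred_eq_of_pos q.den_pos)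
  simp only [rat, Nat.unpair_pair, h1, h2, Rat.num_div_den]

/-- The real line with the usual distance and the rational numbers as ideal points. -/
instance : ComputableMetricSpace ℝ where
  ideal n := ((rat n : ℚ) : ℝ)
  dense_ideal := by
    have h : DenseRange ((↑) : ℚ → ℝ) := Rat.denseRange_cast
    exact h.comp rat_surjective.denseRange Rat.continuous_coe_real
  computable_dist := by
    refine ⟨fun p _ => ratDist p.1 p.2,
      (primrec_ratDist.comp (Primrec.fst.comp Primrec.fst)
        (Primrec.snd.comp Primrec.fst)).to_comp, fun p n => ?_⟩
    simp [rat_ratDist, Real.dist_eq]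

end Real

section Space

variable {X : Type*} [MetricSpace X] [ComputableMetricSpace X]

/-- `x` is computable: some algorithm enumerates ideal points converging fast to `x`. -/
def IsComputablePoint (x : X) : Prop :=
  ∃ A : ℕ → ℕ, Computable A ∧
    ∀ n, dist (ComputableMetricSpace.ideal (X := X) (A n)) x ≤ (2⁻¹ : ℝ) ^ n

variable (X) in
/-- The ideal ball whose number is `b`: centre the ideal point number `b.1`, radius the positive
rational number `b.2`. -/
def idealBall (b : ℕ × ℕ) : Set X :=
  Metric.ball (ComputableMetricSpace.ideal (X := X) b.1) ((posRat b.2 : ℚ) : ℝ)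

/-- The sets `U i` are constructive open sets uniformly in `i`: one (partial) algorithm
enumerates, on input `i`, ideal balls whose union is `U i`. -/
def UniformlyConstructiveOpen {ι : Type*} [Primcodable ι] (U : ι → Set X) : Prop :=
  ∃ A : ι → ℕ →. ℕ × ℕ, Partrec₂ A ∧ ∀ i, U i = ⋃ n, ⋃ b ∈ A i n, idealBall X b

/-- The sets `D i` are constructive `G_δ`-sets uniformly in `i`. -/
def UniformlyConstructiveGδ {ι : Type*} [Primcodable ι] (D : ι → Set X) : Prop :=
  ∃ V : ι × ℕ → Set X, UniformlyConstructiveOpen V ∧ ∀ i, D i = ⋂ n, V (i, n)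

/-- The functions `f i` are computable on `D i`, uniformly in `i`: the preimages of the ideal
balls agree on `D i` with uniformly constructive open sets. -/
def UniformlyComputableOn {Y : Type*} [MetricSpace Y] [ComputableMetricSpace Y]
    {ι : Type*} [Primcodable ι] (f : ι → X → Y) (D : ι → Set X) : Prop :=
  ∃ U : ι × (ℕ × ℕ) → Set X, UniformlyConstructiveOpen U ∧
    ∀ i b, f i ⁻¹' idealBall Y b ∩ D i = U (i, b) ∩ D i

variable [MeasurableSpace X]

/-- The finite measure `∑ q_m • δ_{s_i}`, sum over the entries `(i, m)` of the list, `q_m` the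
positive rational number `m` and `s_i` the ideal point number `i`. -/
noncomputable def idealMeasure (l : List (ℕ × ℕ)) : Measure X :=
  (l.map fun p => ENNReal.ofReal ((posRat p.2 : ℚ) : ℝ) •
    Measure.dirac (ComputableMetricSpace.ideal (X := X) p.1)).sum

/-- `μ` is a computable measure: an algorithm enumerates ideal probability measures converging
fast to `μ` in the Prokhorov metric. -/
def IsComputableMeasure (μ : Measure X) : Prop :=
  ∃ A : ℕ → List (ℕ × ℕ), Computable A ∧ ∀ n,
    IsProbabilityMeasure (idealMeasure (X := X) (A n)) ∧
      levyProkhorovEDist (idealMeasure (X := X) (A n)) μ ≤ (2⁻¹ : ℝ≥0∞) ^ n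

/-- The functions `f i` are uniformly `δ` a.e.-computable: they are uniformly computable on
uniformly constructive `G_δ`-sets of measure one. -/
def UniformlyAEComputable {Y : Type*} [MetricSpace Y] [ComputableMetricSpace Y]
    {ι : Type*} [Primcodable ι] (μ : Measure X) (f : ι → X → Y) : Prop :=
  ∃ D : ι → Set X, UniformlyConstructiveGδ D ∧ (∀ i, μ (D i) = 1) ∧ UniformlyComputableOn f D

/-- The sequence `a` of nonnegative numbers is effectively summable: an algorithm maps a positive
rational `ε` to an index from which on the sum of the tail is at most `ε`. -/
def EffectivelySummable (a : ℕ → ℝ≥0∞) : Prop :=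
  ∃ A : ℕ → ℕ, Computable A ∧
    ∀ e, ∑' i, a (A e + i) ≤ ENNReal.ofReal ((posRat e : ℚ) : ℝ)

/-- Constructive Borel-Cantelli sequences. -/
def IsBorelCantelliSequence (μ : Measure X) (U : ℕ → Set X) : Prop :=
  UniformlyConstructiveOpen U ∧ EffectivelySummable (fun n => μ (U n)ᶜ)

/-- Constructive Borel-Cantelli sets. -/
def IsBorelCantelliSet (μ : Measure X) (R : Set X) : Prop :=
  ∃ U : ℕ → Set X, IsBorelCantelliSequence μ U ∧ R = ⋃ k, ⋂ n ≥ k, U n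

end Space

section Convergence

variable {X : Type*} [MeasurableSpace X]

/-- The functions `g n`, with values in `[0, ∞]`, converge effectively in probability to `0`:
there is a computable `N (ε, δ)`, `ε` and `δ` positive rationals, with `μ {g n ≥ ε} < δ` for all
`n ≥ N (ε, δ)`. -/
def EffectivelyInProbabilityToZero (μ : Measure X) (g : ℕ → X → ℝ≥0∞) : Prop :=
  ∃ N : ℕ → ℕ → ℕ, Computable₂ N ∧ ∀ e d n, N e d ≤ n →
    μ {x | ENNReal.ofReal ((posRat e : ℚ) : ℝ) ≤ g n x} < ENNReal.ofReal ((posRat d : ℚ) : ℝ)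

/-- `f n` converges effectively almost surely to `g`: the functions `sup_{k ≥ n} |f k - g|`
(which may take the value `∞`) converge effectively in probability to `0`. -/
def EffectivelyAlmostSurely (μ : Measure X) (f : ℕ → X → ℝ) (g : X → ℝ) : Prop :=
  EffectivelyInProbabilityToZero μ
    (fun n x => ⨆ k, ⨆ _ : n ≤ k, ENNReal.ofReal |f k x - g x|)

end Convergence

end ConstructiveBC

open ConstructiveBC

/-! Convergence. Two reals are less than `2⁻ⁱ` apart exactly when some interval of radius `2⁻⁽ⁱ⁺¹⁾`
with rational centre contains both, so on the domains of computability the condition `|f k - g| <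
2⁻ⁱ` is constructive open, uniformly in `k` and `i` (`exists_deviation_sets`). Effective almost sure
convergence gives a computable `M` such that, off a set of measure less than `2⁻ⁱ`, this condition
holds for all `k ≥ M i`. Imposing it for all these `k` need not give an open set, so the `i`-th
Borel–Cantelli set imposes it only on the block `M i ≤ k < M (i + 1)`, together with the first `i`
open sets cutting out the domains. A point in almost all of these sets lies in every domain, and the
blocks cover all large `k`.

Computable points. In a complete space every constructive Borel–Cantelli set has computable points
of the support close to any given point of the support (`support_subset_closure`). Fix a tail `G = ⋂
n, U (k + n)`. Although `G` is not open, the property `0 < μ (b ∩ G)` of an ideal ball `b` is r.e.: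
it says that for some rational `ε > 0` the measure of `b ∩ ⋂ U n`, over `k ≤ n < A ε`, exceeds `ε`,
because the remaining `U n` remove at most `ε`. This uses that measures of constructive open sets
are lower semicomputable (`rePred_lt_measure`). Countable additivity then provides, inside each such
`b`, a tiny ball with the same property contained in the next `U n`. An algorithm can search for
such balls, and the nested sequence found shrinks to a computable point of `G` in the support. -/

/-! ### Recursively enumerable predicates: closure properties and effective choice. -/

section RecursivelyEnumerable

variable {α β : Type*} [Primcodable α] [Primcodable β]

/-- A recursively enumerable predicate is the increasing union of primitive recursive stages. -/
theorem REPred.exists_primrec {p : α → Prop} (hp : REPred p) :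
    ∃ q : α → ℕ → Bool, Primrec₂ q ∧ (∀ a s t, s ≤ t → q a s = true → q a t = true) ∧
      ∀ a, p a ↔ ∃ t, q a t = true := by
  obtain ⟨c, hc⟩ := Nat.Partrec.Code.exists_code.1 hp
  refine ⟨fun a t => (Nat.Partrec.Code.evaln t c (Encodable.encode a)).isSome, ?_, ?_, ?_⟩
  · exact Primrec.option_isSome.comp (Nat.Partrec.Code.primrec_evaln.comp
      ((Primrec.snd.pair (Primrec.const c)).pair (Primrec.encode.comp Primrec.fst)))
  · intro a s t hst h
    obtain ⟨x, hx⟩ := Option.isSome_iff_exists.1 h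
    exact Option.isSome_iff_exists.2 ⟨x, Nat.Partrec.Code.evaln_mono hst hx⟩
  · intro a
    have h : (c.eval (Encodable.encode a)).Dom ↔ p a := by
      rw [hc]; simp [Part.assert]
    rw [← h, Part.dom_iff_mem]
    simp only [Nat.Partrec.Code.evaln_complete, Option.isSome_iff_exists, Option.mem_def]
    exact exists_comm

theorem REPred.comp {p : β → Prop} (hp : REPred p) {f : α → β} (hf : Computable f) :
    REPred fun a => p (f a) :=
  Partrec.comp hp hf

theorem REPred.and {p q : α → Prop} (hp : REPred p) (hq : REPred q) :
    REPred fun a => p a ∧ q a :=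
  (Partrec.bind hp (Partrec.comp hq Computable.fst).to₂).dom_re.of_eq fun a => by
    simp [Part.assert]

/-- Effective selection: from an r.e. relation one can compute a partial function choosing, for
each `a`, some `b` related to it if there is one. -/
theorem REPred.exists_selection {p : α → β → Prop} (hp : REPred fun x : α × β => p x.1 x.2) :
    ∃ f : α →. β, Partrec f ∧ (∀ a, ∀ b ∈ f a, p a b) ∧ ∀ a, (∃ b, p a b) → (f a).Dom := by
  obtain ⟨q, hq, -, h⟩ := hp.exists_primrec
  -- Dovetailing: `n` codes a candidate together with the stage up to which it is tested, so the
  -- unbounded search over `n` never gets stuck on a bad candidate.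
  let g : α → ℕ → Option β := fun a n =>
    (Encodable.decode (α := β × ℕ) n).bind fun x => cond (q (a, x.1) x.2) (some x.1) none
  have hg : Primrec₂ g := by
    refine Primrec.option_bind (Primrec.decode.comp Primrec.snd) (Primrec.cond ?_ ?_ ?_)
    · exact hq.comp ((Primrec.fst.comp Primrec.fst).pair (Primrec.fst.comp Primrec.snd))
        (Primrec.snd.comp Primrec.snd)
    · exact Primrec.option_some.comp (Primrec.fst.comp Primrec.snd)
    · exact Primrec.const none
  refine ⟨fun a => Nat.rfindOpt (g a), Partrec.rfindOpt hg.to_comp, fun a b hb => ?_, ?_⟩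
  · obtain ⟨n, hn⟩ := Nat.rfindOpt_spec hb
    obtain ⟨x, -, hx⟩ := Option.bind_eq_some_iff.1 hn
    cases hq' : q (a, x.1) x.2 with
    | false => simp [hq'] at hx
    | true =>
      have e : x.1 = b := by simpa [hq'] using hx
      exact e ▸ (h (a, x.1)).2 ⟨x.2, hq'⟩
  · rintro a ⟨b, hb⟩
    obtain ⟨t, ht⟩ := (h (a, b)).1 hb
    exact Nat.rfindOpt_dom.2 ⟨Encodable.encode (b, t), b, by simp [g, ht]⟩

theorem REPred.exists {p : α → β → Prop} (hp : REPred fun x : α × β => p x.1 x.2) :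
    REPred fun a => ∃ b, p a b := by
  obtain ⟨f, hf, h₁, h₂⟩ := hp.exists_selection
  exact hf.dom_re.of_eq fun a => ⟨fun h => ⟨_, h₁ a _ (Part.get_mem h)⟩, h₂ a⟩

theorem REPred.forall_lt {p : α → ℕ → Prop} (hp : REPred fun x : α × ℕ => p x.1 x.2)
    {h : α → ℕ} (hh : Computable h) : REPred fun a => ∀ n < h a, p a n := by
  -- Runs the semidecision procedures for `n < m` in succession; the run halts exactly when all of
  -- them do.
  let F : α → ℕ →. Unit := fun a m =>
    Nat.rec (Part.some ()) (fun n r => r.bind fun _ => Part.assert (p a n) fun _ => Part.some ()) m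
  have hF : Partrec fun a => F a (h a) := by
    refine Partrec.nat_rec (h := fun a x => Part.assert (p a x.1) fun _ => Part.some ()) hh
      (Computable.const ()).partrec ?_
    exact Partrec.comp hp (Computable.fst.pair (Computable.fst.comp Computable.snd))
  have hdom : ∀ a m, (F a m).Dom ↔ ∀ n < m, p a n := by
    intro a m
    induction m with
    | zero => simp [F]
    | succ m ih =>
      have e : F a (m + 1) =
        (F a m).bind fun _ => Part.assert (p a m) fun _ => Part.some () := rfl
      rw [e, Nat.forall_lt_succ_right]
      simp only [Part.bind_dom, ih, Part.assert]
      simp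
  exact hF.dom_re.of_eq fun a => hdom a (h a)

/-- Dependent choice along an r.e. relation: if every `b` with `P b` has at each stage `n` an
`R`-successor with `P`, then there is a computable sequence of successors. -/
theorem REPred.exists_computable_seq {R : ℕ → β → β → Prop}
    (hR : REPred fun x : (ℕ × β) × β => R x.1.1 x.1.2 x.2) {P : β → Prop}
    (hnext : ∀ n b, P b → ∃ b', R n b b') (hP : ∀ n b b', R n b b' → P b')
    {b₀ : β} (h₀ : P b₀) :
    ∃ s : ℕ → β, Computable s ∧ s 0 = b₀ ∧ ∀ n, R n (s n) (s (n + 1)) := by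
  obtain ⟨f, hf, h₁, h₂⟩ := REPred.exists_selection (p := fun (x : ℕ × β) b' => R x.1 x.2 b') hR
  let F : ℕ →. β := fun m => Nat.rec (Part.some b₀) (fun n r => r.bind fun b => f (n, b)) m
  have hF : Partrec F :=
    Partrec.nat_rec (f := fun m : ℕ => m) (g := fun _ => Part.some b₀)
      (h := fun _ x => f (x.1, x.2)) Computable.id (Computable.const b₀).partrec
      (hf.comp Computable.snd)
  -- The iteration is a priori partial; the invariant `P` guarantees that every search succeeds. `P`
  -- itself need not be r.e.
  have key : ∀ m, ∃ b ∈ F m, P b := by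
    intro m
    induction m with
    | zero => exact ⟨b₀, by simp [F], h₀⟩
    | succ m ih =>
      obtain ⟨b, hb, hPb⟩ := ih
      obtain ⟨b', hb'⟩ := Part.dom_iff_mem.1 (h₂ (m, b) (hnext m b hPb))
      exact ⟨b', Part.mem_bind hb hb', hP _ _ _ (h₁ _ _ hb')⟩
  choose s hs hPs using key
  refine ⟨s, hF.of_eq fun m => Part.eq_some_iff.2 (hs m), ?_, fun n => ?_⟩
  · have := hs 0
    simpa [F] using this
  · obtain ⟨b, hb, hb'⟩ := Part.mem_bind_iff.1 (hs (n + 1))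
    rw [Part.mem_unique (hs n) hb]
    exact h₁ _ _ hb'

end RecursivelyEnumerable

namespace ConstructiveBC

/-! ### Arithmetic and order on codes of rationals. -/

section RationalArithmetic

/-- The number of `rat i + rat j`. -/
def ratAdd (i j : ℕ) : ℕ :=
  Nat.pair (i.unpair.1 * (j.unpair.2.unpair.2 + 1) + j.unpair.1 * (i.unpair.2.unpair.2 + 1))
    (Nat.pair (i.unpair.2.unpair.1 * (j.unpair.2.unpair.2 + 1) +
      j.unpair.2.unpair.1 * (i.unpair.2.unpair.2 + 1))
    (i.unpair.2.unpair.2 * j.unpair.2.unpair.2 + i.unpair.2.unpair.2 + j.unpair.2.unpair.2))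

theorem rat_ratAdd (i j : ℕ) : rat (ratAdd i j) = rat i + rat j := by
  unfold rat ratAdd
  simp only [Nat.unpair_pair]
  push_cast
  field_simp
  ring

theorem primrec_ratAdd : Primrec₂ ratAdd := by
  have one : Primrec fun n : ℕ => n.unpair.1 := Primrec.fst.comp Primrec.unpair
  have two : Primrec fun n : ℕ => n.unpair.2 := Primrec.snd.comp Primrec.unpair
  have i : Primrec fun p : ℕ × ℕ => p.1 := Primrec.fst
  have j : Primrec fun p : ℕ × ℕ => p.2 := Primrec.snd
  have a := one.comp i
  have b := one.comp (two.comp i)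
  have c := two.comp (two.comp i)
  have a' := one.comp j
  have b' := one.comp (two.comp j)
  have c' := two.comp (two.comp j)
  exact Primrec₂.natPair.comp
    (Primrec.nat_add.comp (Primrec.nat_mul.comp a (Primrec.succ.comp c'))
      (Primrec.nat_mul.comp a' (Primrec.succ.comp c)))
    (Primrec₂.natPair.comp
      (Primrec.nat_add.comp (Primrec.nat_mul.comp b (Primrec.succ.comp c'))
        (Primrec.nat_mul.comp b' (Primrec.succ.comp c)))
      (Primrec.nat_add.comp (Primrec.nat_add.comp (Primrec.nat_mul.comp c c') c) c'))

theorem rat_lt_rat_iff (i j : ℕ) : rat i < rat j ↔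
    i.unpair.1 * (j.unpair.2.unpair.2 + 1) + j.unpair.2.unpair.1 * (i.unpair.2.unpair.2 + 1) <
    j.unpair.1 * (i.unpair.2.unpair.2 + 1) + i.unpair.2.unpair.1 * (j.unpair.2.unpair.2 + 1) := by
  unfold rat
  rw [div_lt_div_iff₀ (by positivity) (by positivity), ← @Nat.cast_lt ℚ]
  push_cast
  constructor <;> intro h <;> linarith

theorem primrecRel_rat_lt : PrimrecRel fun i j : ℕ => rat i < rat j := by
  have one : Primrec fun n : ℕ => n.unpair.1 := Primrec.fst.comp Primrec.unpair
  have two : Primrec fun n : ℕ => n.unpair.2 := Primrec.snd.comp Primrec.unpair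
  have i : Primrec fun p : ℕ × ℕ => p.1 := Primrec.fst
  have j : Primrec fun p : ℕ × ℕ => p.2 := Primrec.snd
  have a := one.comp i
  have b := one.comp (two.comp i)
  have c := Primrec.succ.comp (two.comp (two.comp i))
  have a' := one.comp j
  have b' := one.comp (two.comp j)
  have c' := Primrec.succ.comp (two.comp (two.comp j))
  exact (Primrec.nat_lt.comp
    (Primrec.nat_add.comp (Primrec.nat_mul.comp a c') (Primrec.nat_mul.comp b' c))
    (Primrec.nat_add.comp (Primrec.nat_mul.comp a' c) (Primrec.nat_mul.comp b c'))).of_eq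
    fun p => (rat_lt_rat_iff p.1 p.2).symm

theorem rePred_rat_lt {α : Type*} [Primcodable α] {u v : α → ℕ} (hu : Computable u)
    (hv : Computable v) : REPred fun a => rat (u a) < rat (v a) :=
  REPred.comp (p := fun x : ℕ × ℕ => rat x.1 < rat x.2) (f := fun a => (u a, v a))
    (PrimrecPred.computablePred primrecRel_rat_lt).to_re (hu.pair hv)

/-- The number in the numbering `rat` of `posRat n`. -/
def ratOfPosRat (n : ℕ) : ℕ := Nat.pair (n.unpair.1 + 1) (Nat.pair 0 n.unpair.2)

theorem rat_ratOfPosRat (n : ℕ) : rat (ratOfPosRat n) = posRat n := by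
  simp [rat, ratOfPosRat, posRat]

theorem primrec_ratOfPosRat : Primrec ratOfPosRat :=
  Primrec₂.natPair.comp (Primrec.succ.comp (Primrec.fst.comp Primrec.unpair))
    (Primrec₂.natPair.comp (Primrec.const 0) (Primrec.snd.comp Primrec.unpair))

theorem posRat_pos (n : ℕ) : 0 < posRat n := by
  unfold posRat; positivity

theorem posRat_cast_pos (n : ℕ) : (0 : ℝ) < ((posRat n : ℚ) : ℝ) := by
  exact_mod_cast posRat_pos n

/-- The number in the numbering `posRat` of `2⁻ⁿ`. -/
def halfPow (n : ℕ) : ℕ := Nat.pair 0 (2 ^ n - 1)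

theorem posRat_halfPow (n : ℕ) : ((posRat (halfPow n) : ℚ) : ℝ) = (2⁻¹ : ℝ) ^ n := by
  simp [posRat, halfPow]

theorem primrec_halfPow : Primrec halfPow := by
  have h : Primrec fun n : ℕ => 2 ^ n :=
    (Primrec.nat_rec₁ 1 (f := fun _ r => 2 * r)
      (Primrec.nat_mul.comp (Primrec.const 2) Primrec.snd)).of_eq fun n => by
      induction n with
      | zero => rfl
      | succ n ih => rw [pow_succ, mul_comm, ← ih]
  exact Primrec₂.natPair.comp (Primrec.const 0) (Primrec.nat_sub.comp h (Primrec.const 1))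

theorem exists_halfPow_lt {ε : ℝ} (hε : 0 < ε) : ∃ n, (2⁻¹ : ℝ) ^ n < ε :=
  exists_pow_lt_of_lt_one hε (by norm_num)

theorem exists_posRat_lt {ε : ℝ≥0∞} (hε : 0 < ε) :
    ∃ e, ENNReal.ofReal ((posRat e : ℚ) : ℝ) < ε := by
  obtain ⟨r, hr, hrε⟩ := ENNReal.lt_iff_exists_nnreal_btwn.1 hε
  obtain ⟨n, hn⟩ := exists_halfPow_lt (NNReal.coe_pos.2 (ENNReal.coe_pos.1 hr))
  refine ⟨halfPow n, lt_trans ?_ hrε⟩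
  rw [posRat_halfPow, ← ENNReal.ofReal_coe_nnreal]
  exact (ENNReal.ofReal_lt_ofReal_iff (NNReal.coe_pos.2 (ENNReal.coe_pos.1 hr))).2 hn

end RationalArithmetic

/-! ### Constructive open sets and their closure properties. -/

section ConstructiveOpen

variable {X : Type*} [MetricSpace X] [ComputableMetricSpace X]

variable (X) in
/-- Strict inequalities between distances of ideal points and rationals are r.e. -/
theorem rePred_dist_add_lt : REPred fun x : (ℕ × ℕ) × ℕ × ℕ =>
    dist (ComputableMetricSpace.ideal (X := X) x.1.1) (ComputableMetricSpace.ideal x.1.2) +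
      ((rat x.2.1 : ℚ) : ℝ) < ((rat x.2.2 : ℚ) : ℝ) := by
  obtain ⟨A, hA, hd⟩ := ComputableMetricSpace.computable_dist (X := X)
  have hre : REPred fun y : ((ℕ × ℕ) × ℕ × ℕ) × ℕ =>
      rat (ratAdd (ratAdd (A y.1.1 y.2) (ratOfPosRat (halfPow y.2))) y.1.2.1) < rat y.1.2.2 := by
    refine rePred_rat_lt (primrec_ratAdd.to_comp.comp (primrec_ratAdd.to_comp.comp
      (hA.comp (Computable.fst.comp Computable.fst) Computable.snd)
      ((primrec_ratOfPosRat.comp primrec_halfPow).to_comp.comp Computable.snd)) ?_) ?_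
    · exact Computable.fst.comp (Computable.snd.comp Computable.fst)
    · exact Computable.snd.comp (Computable.snd.comp Computable.fst)
  -- The approximation `A x.1 n` plus its error `2⁻ⁿ` bounds the distance from above, within `2 *
  -- 2⁻ⁿ`; a strict inequality is therefore confirmed at some precision `n`.
  refine (REPred.exists (p := fun (x : (ℕ × ℕ) × ℕ × ℕ) (n : ℕ) =>
    rat (ratAdd (ratAdd (A x.1 n) (ratOfPosRat (halfPow n))) x.2.1) < rat x.2.2) hre).of_eq ?_
  rintro ⟨p, r, R⟩
  have key : ∀ n, rat (ratAdd (ratAdd (A p n) (ratOfPosRat (halfPow n))) r) < rat R ↔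
      ((rat (A p n) : ℚ) : ℝ) + (2⁻¹ : ℝ) ^ n + ((rat r : ℚ) : ℝ) < ((rat R : ℚ) : ℝ) := by
    intro n
    rw [← Rat.cast_lt (K := ℝ), rat_ratAdd, rat_ratAdd, rat_ratOfPosRat]
    push_cast
    rw [posRat_halfPow]
  simp only [key]
  constructor
  · rintro ⟨n, hn⟩
    have := (abs_le.1 (hd p n)).1
    dsimp only at this
    linarith
  · intro h
    obtain ⟨n, hn⟩ := exists_halfPow_lt (half_pos (sub_pos.2 h))
    refine ⟨n, ?_⟩
    have := (abs_le.1 (hd p n)).2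
    dsimp only at this
    linarith

variable (X) in
/-- Formal strict inclusion of ideal balls. -/
def FormallyInside (b c : ℕ × ℕ) : Prop :=
  dist (ComputableMetricSpace.ideal (X := X) b.1) (ComputableMetricSpace.ideal c.1) +
    ((posRat b.2 : ℚ) : ℝ) < ((posRat c.2 : ℚ) : ℝ)

variable (X) in
theorem rePred_formallyInside :
    REPred fun x : (ℕ × ℕ) × (ℕ × ℕ) => FormallyInside X x.1 x.2 := by
  refine ((rePred_dist_add_lt X).comp (f := fun x : (ℕ × ℕ) × (ℕ × ℕ) =>
    ((x.1.1, x.2.1), (ratOfPosRat x.1.2, ratOfPosRat x.2.2))) ?_).of_eq fun x => by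
      simp only [rat_ratOfPosRat, FormallyInside]
  have h1 : Computable fun x : (ℕ × ℕ) × (ℕ × ℕ) => x.1 := Computable.fst
  have h2 : Computable fun x : (ℕ × ℕ) × (ℕ × ℕ) => x.2 := Computable.snd
  exact ((Computable.fst.comp h1).pair (Computable.fst.comp h2)).pair
    ((primrec_ratOfPosRat.to_comp.comp (Computable.snd.comp h1)).pair
      (primrec_ratOfPosRat.to_comp.comp (Computable.snd.comp h2)))

/-- The closed ball is captured too, which is what limits of nested centres need. -/
theorem FormallyInside.mem_of_dist_le {b c : ℕ × ℕ} (h : FormallyInside X b c) {x : X}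
    (hx : dist (ComputableMetricSpace.ideal b.1) x ≤ ((posRat b.2 : ℚ) : ℝ)) :
    x ∈ idealBall X c := by
  rw [idealBall, Metric.mem_ball']
  have := dist_triangle_left x (ComputableMetricSpace.ideal c.1)
    (ComputableMetricSpace.ideal (X := X) b.1)
  have := dist_comm x (ComputableMetricSpace.ideal (X := X) c.1)
  unfold FormallyInside at h
  linarith

theorem FormallyInside.subset {b c : ℕ × ℕ} (h : FormallyInside X b c) :
    idealBall X b ⊆ idealBall X c := fun x hx =>
  h.mem_of_dist_le (by rw [idealBall, Metric.mem_ball'] at hx; exact hx.le)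

theorem isOpen_idealBall (b : ℕ × ℕ) : IsOpen (idealBall X b) := Metric.isOpen_ball

theorem exists_mem_idealBall_radius_lt (x : X) {ε : ℝ} (hε : 0 < ε) :
    ∃ b : ℕ × ℕ, x ∈ idealBall X b ∧ ((posRat b.2 : ℚ) : ℝ) < ε := by
  obtain ⟨n, hn⟩ := exists_halfPow_lt hε
  obtain ⟨i, hi⟩ := (ComputableMetricSpace.dense_ideal (X := X)).exists_dist_lt x
    (posRat_cast_pos (halfPow n))
  exact ⟨(i, halfPow n), hi, by simpa only [posRat_halfPow] using hn⟩

/-- Half of the slack of `x` in `c` bounds the admissible radii. The filter form lets finitely many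
such bounds be met at once. -/
theorem eventually_formallyInside {x : X} {c : ℕ × ℕ} (hx : x ∈ idealBall X c) :
    ∀ᶠ ε : ℝ in 𝓝[>] 0, ∀ b : ℕ × ℕ, x ∈ idealBall X b → ((posRat b.2 : ℚ) : ℝ) < ε →
      FormallyInside X b c := by
  rw [idealBall, Metric.mem_ball] at hx
  filter_upwards [Ioo_mem_nhdsGT (half_pos (sub_pos.2 hx))] with ε hε b hb hbε
  rw [idealBall, Metric.mem_ball'] at hb
  have := dist_triangle (ComputableMetricSpace.ideal (X := X) b.1) x
    (ComputableMetricSpace.ideal c.1)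
  have := hε.2
  unfold FormallyInside
  linarith

/-- The constructive open sets are the unions of r.e. families of ideal balls, uniformly. -/
theorem uniformlyConstructiveOpen_iff {ι : Type*} [Primcodable ι] {U : ι → Set X} :
    UniformlyConstructiveOpen U ↔ ∃ W : ι → ℕ × ℕ → Prop,
      REPred (fun x : ι × (ℕ × ℕ) => W x.1 x.2) ∧
      ∀ i x, x ∈ U i ↔ ∃ b, W i b ∧ x ∈ idealBall X b := by
  constructor
  · rintro ⟨A, hA, hU⟩
    refine ⟨fun i b => ∃ n, b ∈ A i n, ?_, fun i x => ?_⟩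
    · refine REPred.exists (p := fun (x : ι × (ℕ × ℕ)) (n : ℕ) => x.2 ∈ A x.1 n) ?_
      have hp : Partrec fun y : (ι × (ℕ × ℕ)) × ℕ => A y.1.1 y.2 :=
        hA.comp (Computable.fst.comp Computable.fst) Computable.snd
      have he : REPred fun z : ((ι × (ℕ × ℕ)) × ℕ) × (ℕ × ℕ) => z.1.1.2 = z.2 :=
        (PrimrecPred.computablePred (Primrec.eq (α := ℕ × ℕ))).to_re.comp
          ((Computable.snd.comp (Computable.fst.comp Computable.fst)).pair Computable.snd)
      refine (Partrec.bind hp he.to₂).dom_re.of_eq fun y => ?_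
      rw [Part.bind_dom]
      constructor
      · rintro ⟨h, h'⟩
        have e : y.1.2 = (A y.1.1 y.2).get h := h'.1
        exact e ▸ Part.get_mem h
      · intro h
        exact ⟨h.1, (Part.get_eq_of_mem h h.1).symm, trivial⟩
    · rw [hU i]
      simp only [Set.mem_iUnion, exists_prop]
      exact ⟨fun ⟨n, b, h, h'⟩ => ⟨b, ⟨n, h⟩, h'⟩, fun ⟨b, ⟨n, h⟩, h'⟩ => ⟨n, b, h, h'⟩⟩
  · rintro ⟨W, hW, hU⟩
    -- The enumeration outputs, on input `(i, n)`, the ball with code `n` if it belongs to the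
    -- family and diverges otherwise; partiality makes the empty family harmless.
    have hp : REPred fun x : (ι × ℕ) × (ℕ × ℕ) =>
        Encodable.encode x.2 = x.1.2 ∧ W x.1.1 x.2 := by
      refine REPred.and ?_ ?_
      · exact (PrimrecPred.computablePred (Primrec.eq (α := ℕ))).to_re.comp
          ((Computable.encode.comp Computable.snd).pair (Computable.snd.comp Computable.fst))
      · exact hW.comp ((Computable.fst.comp Computable.fst).pair Computable.snd)
    obtain ⟨f, hf, h₁, h₂⟩ := REPred.exists_selection
      (p := fun (x : ι × ℕ) b => Encodable.encode b = x.2 ∧ W x.1 b) hp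
    refine ⟨fun i n => f (i, n), hf, fun i => Set.ext fun x => ?_⟩
    simp only [Set.mem_iUnion, exists_prop, hU]
    constructor
    · rintro ⟨b, hb, hx⟩
      obtain ⟨b', hb'⟩ := Part.dom_iff_mem.1 (h₂ (i, Encodable.encode b) ⟨b, rfl, hb⟩)
      have e : b' = b := Encodable.encode_injective (h₁ _ _ hb').1
      exact ⟨_, b', hb', e ▸ hx⟩
    · rintro ⟨n, b, hb, hx⟩
      exact ⟨b, (h₁ _ _ hb).2, hx⟩

variable {ι κ : Type*} [Primcodable ι] [Primcodable κ]

theorem UniformlyConstructiveOpen.isOpen {U : ι → Set X} (hU : UniformlyConstructiveOpen U)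
    (i : ι) : IsOpen (U i) := by
  obtain ⟨A, -, h⟩ := hU
  rw [h i]
  exact isOpen_iUnion fun n => isOpen_biUnion fun b _ => isOpen_idealBall b

theorem UniformlyConstructiveOpen.comp {U : ι → Set X} (hU : UniformlyConstructiveOpen U)
    {h : κ → ι} (hh : Computable h) : UniformlyConstructiveOpen fun k => U (h k) := by
  obtain ⟨A, hA, hU⟩ := hU
  exact ⟨fun k n => A (h k) n, hA.comp (hh.comp Computable.fst) Computable.snd, fun k => hU (h k)⟩

theorem uniformlyConstructiveOpen_idealBall :
    UniformlyConstructiveOpen fun b : ℕ × ℕ => idealBall X b :=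
  ⟨fun b _ => Part.some b, Computable.fst.partrec, fun b => by
    ext x
    simp⟩

theorem UniformlyConstructiveOpen.iUnion {U : ι → κ → Set X}
    (hU : UniformlyConstructiveOpen fun p : ι × κ => U p.1 p.2) :
    UniformlyConstructiveOpen fun i => ⋃ k, U i k := by
  obtain ⟨W, hW, h⟩ := uniformlyConstructiveOpen_iff.1 hU
  refine uniformlyConstructiveOpen_iff.2 ⟨fun i b => ∃ k, W (i, k) b, ?_, fun i x => ?_⟩
  · exact REPred.exists (p := fun (x : ι × (ℕ × ℕ)) k => W (x.1, k) x.2)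
      (hW.comp (((Computable.fst.comp Computable.fst).pair Computable.snd).pair
        (Computable.snd.comp Computable.fst)))
  · have h' : ∀ k, x ∈ U i k ↔ _ := fun k => h (i, k) x
    simp only [Set.mem_iUnion, h']
    exact ⟨fun ⟨k, b, h, h'⟩ => ⟨b, ⟨k, h⟩, h'⟩, fun ⟨b, ⟨k, h⟩, h'⟩ => ⟨k, b, h, h'⟩⟩

/-- Intersections of finitely many constructive open sets are constructive open, uniformly also in
the number of the sets. -/
theorem UniformlyConstructiveOpen.iInter_lt {U : ι → ℕ → Set X}
    (hU : UniformlyConstructiveOpen fun p : ι × ℕ => U p.1 p.2) {m : ι → ℕ} (hm : Computable m) :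
    UniformlyConstructiveOpen fun i => ⋂ n < m i, U i n := by
  obtain ⟨W, hW, h⟩ := uniformlyConstructiveOpen_iff.1 hU
  refine uniformlyConstructiveOpen_iff.2
    -- Formal inclusion replaces inclusion of balls as sets because it is r.e.; small balls around a
    -- point of the intersection satisfy it.
    ⟨fun i b => ∀ n < m i, ∃ c, W (i, n) c ∧ FormallyInside X b c, ?_, fun i x => ?_⟩
  · refine REPred.forall_lt
      (p := fun (x : ι × (ℕ × ℕ)) n => ∃ c, W (x.1, n) c ∧ FormallyInside X x.2 c)
      ?_ (hm.comp Computable.fst)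
    refine REPred.exists (p := fun (y : (ι × (ℕ × ℕ)) × ℕ) c =>
      W (y.1.1, y.2) c ∧ FormallyInside X y.1.2 c) ?_
    have h1 : Computable fun z : ((ι × (ℕ × ℕ)) × ℕ) × (ℕ × ℕ) => z.1.1 :=
      Computable.fst.comp Computable.fst
    refine REPred.and
      (REPred.comp (f := fun z : ((ι × (ℕ × ℕ)) × ℕ) × (ℕ × ℕ) => ((z.1.1.1, z.1.2), z.2)) hW
        (((Computable.fst.comp h1).pair (Computable.snd.comp Computable.fst)).pair Computable.snd))
      (REPred.comp (f := fun z : ((ι × (ℕ × ℕ)) × ℕ) × (ℕ × ℕ) => (z.1.1.2, z.2))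
        (rePred_formallyInside X) ((Computable.snd.comp h1).pair Computable.snd))
  · have h' : ∀ n, x ∈ U i n ↔ _ := fun n => h (i, n) x
    simp only [Set.mem_iInter, h']
    constructor
    · intro H
      have hev : ∀ᶠ ε : ℝ in 𝓝[>] 0, ∀ n ∈ Set.Iio (m i), ∃ c, W (i, n) c ∧
          ∀ b : ℕ × ℕ, x ∈ idealBall X b → ((posRat b.2 : ℚ) : ℝ) < ε → FormallyInside X b c := by
        refine (eventually_all_finite (Set.finite_Iio (m i))).2 fun n hn => ?_
        obtain ⟨c, hc, hxc⟩ := H n hn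
        exact (eventually_formallyInside hxc).mono fun ε hε => ⟨c, hc, hε⟩
      obtain ⟨ε, hε, hε0⟩ := (hev.and self_mem_nhdsWithin).exists
      obtain ⟨b, hxb, hb⟩ := exists_mem_idealBall_radius_lt x (Set.mem_Ioi.1 hε0)
      exact ⟨b, fun n hn => (hε n hn).imp fun c hc => ⟨hc.1, hc.2 b hxb hb⟩, hxb⟩
    · rintro ⟨b, hb, hxb⟩ n hn
      exact (hb n hn).imp fun c hc => ⟨hc.1, hc.2.subset hxb⟩

theorem UniformlyConstructiveOpen.inter {U V : ι → Set X} (hU : UniformlyConstructiveOpen U)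
    (hV : UniformlyConstructiveOpen V) : UniformlyConstructiveOpen fun i => U i ∩ V i := by
  obtain ⟨W, hW, h⟩ := uniformlyConstructiveOpen_iff.1 hU
  obtain ⟨W', hW', h'⟩ := uniformlyConstructiveOpen_iff.1 hV
  refine uniformlyConstructiveOpen_iff.2 ⟨fun i b => (∃ c, W i c ∧ FormallyInside X b c) ∧
    ∃ c, W' i c ∧ FormallyInside X b c, ?_, fun i x => ?_⟩
  · have hc : ∀ {W : ι → ℕ × ℕ → Prop}, REPred (fun x : ι × (ℕ × ℕ) => W x.1 x.2) →
        REPred fun x : ι × (ℕ × ℕ) => ∃ c, W x.1 c ∧ FormallyInside X x.2 c := by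
      intro W hW
      refine REPred.exists (p := fun (x : ι × (ℕ × ℕ)) c => W x.1 c ∧ FormallyInside X x.2 c)
        (REPred.and
          (REPred.comp (f := fun z : (ι × (ℕ × ℕ)) × (ℕ × ℕ) => (z.1.1, z.2)) hW
            ((Computable.fst.comp Computable.fst).pair Computable.snd))
          (REPred.comp (f := fun z : (ι × (ℕ × ℕ)) × (ℕ × ℕ) => (z.1.2, z.2))
            (rePred_formallyInside X) ((Computable.snd.comp Computable.fst).pair Computable.snd)))
    exact (hc hW).and (hc hW')
  · rw [Set.mem_inter_iff, h, h']
    constructor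
    · rintro ⟨⟨c, hc, hxc⟩, c', hc', hxc'⟩
      obtain ⟨ε, ⟨hε, hε'⟩, hε0⟩ := (((eventually_formallyInside hxc).and
        (eventually_formallyInside hxc')).and self_mem_nhdsWithin).exists
      obtain ⟨b, hxb, hb⟩ := exists_mem_idealBall_radius_lt x (Set.mem_Ioi.1 hε0)
      exact ⟨b, ⟨⟨c, hc, hε b hxb hb⟩, c', hc', hε' b hxb hb⟩, hxb⟩
    · rintro ⟨b, ⟨⟨c, hc, hb⟩, c', hc', hb'⟩, hxb⟩
      exact ⟨⟨c, hc, hb.subset hxb⟩, c', hc', hb'.subset hxb⟩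

end ConstructiveOpen

/-! ### From effective almost sure convergence to a Borel–Cantelli set. -/

section AlmostSureConvergence

variable {X : Type*} [MetricSpace X] [ComputableMetricSpace X]

/-- A rational close to the midpoint serves as centre. This reduces comparing two functions to
preimages of single intervals. -/
theorem exists_idealBall_real_iff (a b r : ℝ) :
    (∃ q : ℕ, a ∈ Metric.ball (ComputableMetricSpace.ideal (X := ℝ) q) r ∧
      b ∈ Metric.ball (ComputableMetricSpace.ideal (X := ℝ) q) r) ↔ |a - b| < 2 * r := by
  constructor
  · rintro ⟨q, ha, hb⟩
    rw [Metric.mem_ball] at ha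
    rw [Metric.mem_ball'] at hb
    have := dist_triangle a (ComputableMetricSpace.ideal (X := ℝ) q) b
    rw [Real.dist_eq a b] at this
    linarith
  · intro h
    obtain ⟨q, hq⟩ := (ComputableMetricSpace.dense_ideal (X := ℝ)).exists_mem_open
      (Metric.isOpen_ball.inter Metric.isOpen_ball : IsOpen (Metric.ball a r ∩ Metric.ball b r))
      ⟨(a + b) / 2, by
        rw [abs_lt] at h
        simp only [Set.mem_inter_iff, Metric.mem_ball, Real.dist_eq, abs_lt]
        refine ⟨⟨?_, ?_⟩, ?_, ?_⟩ <;> linarith⟩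
    exact ⟨q, Metric.mem_ball_comm.1 hq.1, Metric.mem_ball_comm.1 hq.2⟩

theorem UniformlyComputableOn.exists_deviation_sets {f : ℕ → X → ℝ} {g : X → ℝ}
    {D : ℕ → Set X} {E : Unit → Set X} (hf : UniformlyComputableOn f D)
    (hg : UniformlyComputableOn (fun _ : Unit => g) E) :
    ∃ O : ℕ × ℕ → Set X, UniformlyConstructiveOpen O ∧ ∀ k i, ∀ x ∈ D k, x ∈ E () →
      (x ∈ O (k, i) ↔ |f k x - g x| < (2⁻¹ : ℝ) ^ i) := by
  obtain ⟨U, hU, hfU⟩ := hf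
  obtain ⟨U', hU', hgU'⟩ := hg
  refine ⟨fun p => ⋃ q, U (p.1, (q, halfPow (p.2 + 1))) ∩ U' ((), (q, halfPow (p.2 + 1))), ?_, ?_⟩
  · have hr : Computable fun y : (ℕ × ℕ) × ℕ => (y.2, halfPow (y.1.2 + 1)) :=
      Computable.snd.pair ((primrec_halfPow.comp Primrec.succ).to_comp.comp
        (Computable.snd.comp Computable.fst))
    refine UniformlyConstructiveOpen.iUnion (U := fun (p : ℕ × ℕ) q =>
      U (p.1, (q, halfPow (p.2 + 1))) ∩ U' ((), (q, halfPow (p.2 + 1)))) ?_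
    exact UniformlyConstructiveOpen.inter
      (U := fun y : (ℕ × ℕ) × ℕ => U (y.1.1, (y.2, halfPow (y.1.2 + 1))))
      (V := fun y : (ℕ × ℕ) × ℕ => U' ((), (y.2, halfPow (y.1.2 + 1))))
      (hU.comp ((Computable.fst.comp Computable.fst).pair hr))
      (hU'.comp ((Computable.const ()).pair hr))
  · intro k i x hx hx'
    have h₁ : ∀ b, x ∈ U (k, b) ↔ f k x ∈ idealBall ℝ b := fun b => by
      have := Set.ext_iff.1 (hfU k b) x
      simpa [hx] using this.symm
    have h₂ : ∀ b, x ∈ U' ((), b) ↔ g x ∈ idealBall ℝ b := fun b => by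
      have := Set.ext_iff.1 (hgU' () b) x
      simpa [hx'] using this.symm
    simp only [Set.mem_iUnion, Set.mem_inter_iff, h₁, h₂, idealBall, posRat_halfPow]
    rw [exists_idealBall_real_iff, pow_succ', mul_inv_cancel_left₀ two_ne_zero]

theorem tsum_half_pow_add_le (k : ℕ) :
    ∑' i, ENNReal.ofReal ((2⁻¹ : ℝ) ^ (k + 1 + i)) = ENNReal.ofReal ((2⁻¹ : ℝ) ^ k) := by
  have h2 : ENNReal.ofReal (2⁻¹ : ℝ) = 2⁻¹ := by
    rw [ENNReal.ofReal_inv_of_pos two_pos]; simp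
  have h : ∀ i, ENNReal.ofReal ((2⁻¹ : ℝ) ^ (k + 1 + i)) = 2⁻¹ ^ (k + 1) * 2⁻¹ ^ i := fun i => by
    rw [ENNReal.ofReal_pow (by norm_num), h2, pow_add]
  simp only [h]
  rw [ENNReal.tsum_mul_left, ENNReal.tsum_geometric, ENNReal.one_sub_inv_two, inv_inv, pow_succ,
    mul_assoc, ENNReal.inv_mul_cancel two_ne_zero (by simp), mul_one,
    ENNReal.ofReal_pow (by norm_num), h2]

variable [MeasurableSpace X]

theorem effectivelySummable_of_le_half_pow {a : ℕ → ℝ≥0∞}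
    (h : ∀ n, a n ≤ ENNReal.ofReal ((2⁻¹ : ℝ) ^ n)) : EffectivelySummable a := by
  -- With `b = e.unpair.2`, `posRat e ≥ 1 / (b + 1) ≥ 2⁻ᵇ`, and `2⁻ᵇ` is the geometric tail starting
  -- at `b + 1`.
  refine ⟨fun e => e.unpair.2 + 1,
    (Primrec.succ.comp (Primrec.snd.comp Primrec.unpair)).to_comp, fun e => ?_⟩
  refine (ENNReal.tsum_le_tsum fun i => h _).trans ?_
  rw [tsum_half_pow_add_le]
  refine ENNReal.ofReal_le_ofReal ?_
  have h1 : ((e.unpair.2 : ℝ) + 1) ≤ 2 ^ e.unpair.2 := by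
    exact_mod_cast (Nat.lt_two_pow_self : e.unpair.2 < 2 ^ e.unpair.2)
  rw [inv_pow, posRat]
  push_cast
  rw [inv_eq_one_div]
  exact div_le_div₀ (by positivity) (by linarith [(Nat.cast_nonneg _ : (0 : ℝ) ≤ e.unpair.1)])
    (by positivity) h1

/-- The blocks `[M i, M (i + 1))` cover all large indices even if `M` is not monotone: since `M` is
unbounded, each `k` is passed at some step. -/
theorem tendsto_of_eventually_abs_sub_lt {u : ℕ → ℝ} {l : ℝ} {M : ℕ → ℕ} (hM : ∀ i, i ≤ M i)
    {k₀ : ℕ} (h : ∀ i ≥ k₀, ∀ k, M i ≤ k → k < M (i + 1) → |u k - l| < (2⁻¹ : ℝ) ^ i) :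
    Tendsto u atTop (𝓝 l) := by
  rw [Metric.tendsto_atTop]
  intro ε hε
  obtain ⟨i₁, hi₁⟩ := exists_halfPow_lt hε
  let i₀ := max i₁ k₀
  have hbound : ∀ i, i₀ ≤ i → (2⁻¹ : ℝ) ^ i < ε := fun i hi =>
    (pow_le_pow_of_le_one (by norm_num) (by norm_num) ((le_max_left _ _).trans hi)).trans_lt hi₁
  have key : ∀ j, i₀ ≤ j → ∀ k, M i₀ ≤ k → k < M j → |u k - l| < ε := by
    intro j hj
    induction j, hj using Nat.le_induction with
    | base => intro k h1 h2; omega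
    | succ j hj ih =>
      intro k h1 h2
      rcases lt_or_ge k (M j) with h3 | h3
      · exact ih k h1 h3
      · exact (h j ((le_max_right _ _).trans hj) k h3 h2).trans (hbound j hj)
  refine ⟨M i₀, fun k hk => ?_⟩
  rw [Real.dist_eq]
  exact key (k + 1) ((hM i₀).trans (by omega)) k hk (Nat.lt_of_succ_le (hM (k + 1)))

theorem EffectivelyAlmostSurely.exists_isBorelCantelliSet [BorelSpace X] {μ : Measure X}
    [IsProbabilityMeasure μ] {f : ℕ → X → ℝ} {g : X → ℝ} (hf : UniformlyAEComputable μ f)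
    (hg : UniformlyAEComputable μ fun _ : Unit => g) (hconv : EffectivelyAlmostSurely μ f g) :
    ∃ R : Set X, IsBorelCantelliSet μ R ∧ R ⊆ {x | Tendsto (fun n => f n x) atTop (𝓝 (g x))} := by
  obtain ⟨D, ⟨V, hV, hDV⟩, hμD, hfD⟩ := hf
  obtain ⟨E, ⟨V', hV', hEV'⟩, hμE, hgE⟩ := hg
  obtain ⟨O, hO, hOfg⟩ := hfD.exists_deviation_sets hgE
  obtain ⟨N, hN, hNμ⟩ := hconv
  -- The summand `i` forces `i ≤ M i`.
  let M : ℕ → ℕ := fun i => N (halfPow i) (halfPow i) + i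
  have hM : Computable M := Primrec.nat_add.to_comp.comp
    (hN.comp primrec_halfPow.to_comp primrec_halfPow.to_comp) Computable.id
  -- Truncated subtraction makes the block empty when `M (i + 1) ≤ M i`. The sets `V` are listed
  -- through the pairing function, so each one is imposed from some index on.
  let T : ℕ → Set X := fun i => (⋂ j < M (i + 1) - M i, O (M i + j, i)) ∩
    ((⋂ n < i, V n.unpair) ∩ ⋂ n < i, V' ((), n))
  have hT : UniformlyConstructiveOpen T := by
    refine UniformlyConstructiveOpen.inter ?_ (UniformlyConstructiveOpen.inter ?_ ?_)
    · refine UniformlyConstructiveOpen.iInter_lt (U := fun i j => O (M i + j, i)) ?_ ?_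
      · exact hO.comp ((Primrec.nat_add.to_comp.comp (hM.comp Computable.fst)
          Computable.snd).pair Computable.fst)
      · exact Primrec.nat_sub.to_comp.comp (hM.comp Computable.succ) hM
    · exact UniformlyConstructiveOpen.iInter_lt (U := fun (_ : ℕ) n => V n.unpair)
        (hV.comp (Computable.unpair.comp Computable.snd)) Computable.id
    · exact UniformlyConstructiveOpen.iInter_lt (U := fun (_ : ℕ) n => V' ((), n))
        (hV'.comp ((Computable.const ()).pair Computable.snd)) Computable.id
  have hD0 : ∀ n, μ (D n)ᶜ = 0 := fun n => by
    have hm : MeasurableSet (D n) := hDV n ▸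
      MeasurableSet.iInter fun m => (hV.isOpen (n, m)).measurableSet
    exact (prob_compl_eq_zero_iff hm).2 (hμD n)
  have hE0 : μ (E ())ᶜ = 0 := by
    have hm : MeasurableSet (E ()) := hEV' () ▸
      MeasurableSet.iInter fun m => (hV'.isOpen ((), m)).measurableSet
    exact (prob_compl_eq_zero_iff hm).2 (hμE ())
  refine ⟨_, ⟨T, ⟨hT, effectivelySummable_of_le_half_pow fun i => ?_⟩, rfl⟩, ?_⟩
  -- The domain conditions cost only a null set; the block condition is controlled by the supremum
  -- from `M i` on.
  · have hsub : (T i)ᶜ ⊆ ((⋃ n, (D n)ᶜ) ∪ (E ())ᶜ) ∪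
        {x | ENNReal.ofReal ((posRat (halfPow i) : ℚ) : ℝ) ≤
          ⨆ k, ⨆ _ : M i ≤ k, ENNReal.ofReal |f k x - g x|} := by
      intro x hx
      by_contra hc
      simp only [Set.mem_union, Set.mem_iUnion, Set.mem_compl_iff, Set.mem_ofPred_eq, not_or,
        not_exists, not_not, not_le] at hc
      obtain ⟨⟨hxD, hxE⟩, hlt⟩ := hc
      refine hx ⟨Set.mem_iInter₂.2 fun j _ => ?_, Set.mem_iInter₂.2 fun n _ => ?_,
        Set.mem_iInter₂.2 fun n _ => ?_⟩
      · rw [hOfg _ _ x (hxD _) hxE, ← posRat_halfPow]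
        refine (ENNReal.ofReal_lt_ofReal_iff (posRat_cast_pos _)).1 (lt_of_le_of_lt ?_ hlt)
        exact le_iSup₂ (f := fun k (_ : M i ≤ k) => ENNReal.ofReal |f k x - g x|)
          (M i + j) (Nat.le_add_right _ _)
      · have := hxD n.unpair.1
        rw [hDV] at this
        exact Set.mem_iInter.1 this n.unpair.2
      · rw [hEV'] at hxE
        exact Set.mem_iInter.1 hxE n
    refine (measure_mono hsub).trans ((measure_union_le _ _).trans ?_)
    rw [measure_union_null (measure_iUnion_null hD0) hE0, zero_add]
    exact ((hNμ _ _ _ (Nat.le_add_right _ _)).trans_eq (by rw [posRat_halfPow])).le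
  · intro x hx
    obtain ⟨k₀, hk₀⟩ := Set.mem_iUnion.1 hx
    have hxT : ∀ n ≥ k₀, x ∈ T n := Set.mem_iInter₂.1 hk₀
    have hxD : ∀ n, x ∈ D n := fun n => by
      rw [hDV]
      refine Set.mem_iInter.2 fun m => ?_
      have := Set.mem_iInter₂.1 (hxT (max k₀ (Nat.pair n m + 1)) (le_max_left _ _)).2.1
        (Nat.pair n m) (Nat.lt_of_succ_le (le_max_right _ _))
      rwa [Nat.unpair_pair] at this
    have hxE : x ∈ E () := by
      rw [hEV']
      exact Set.mem_iInter.2 fun m => Set.mem_iInter₂.1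
        (hxT (max k₀ (m + 1)) (le_max_left _ _)).2.2 m (Nat.lt_of_succ_le (le_max_right _ _))
    refine tendsto_of_eventually_abs_sub_lt (M := M) (k₀ := k₀) (fun i => Nat.le_add_left _ _) ?_
    intro i hi k hik hki
    have := Set.mem_iInter₂.1 (hxT i hi).1 (k - M i) (by omega)
    rw [Nat.add_sub_cancel' hik] at this
    exact (hOfg k i x (hxD k) hxE).1 this

end AlmostSureConvergence

/-! ### Lower semicomputability of the measure of constructive open sets. -/

section LowerSemicomputability

variable {X : Type*} [MetricSpace X] [ComputableMetricSpace X]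

/-- The number of the sum of the weights of those entries of the list that satisfy `q`. -/
def listWeight (q : ℕ × ℕ → Bool) (l : List (ℕ × ℕ)) : ℕ :=
  l.foldr (fun p s => cond (q p) (ratAdd (ratOfPosRat p.2) s) s) 0

theorem rat_zero : rat 0 = 0 := by simp [rat]

theorem rat_listWeight_cons (q : ℕ × ℕ → Bool) (p : ℕ × ℕ) (l : List (ℕ × ℕ)) :
    rat (listWeight q (p :: l)) = cond (q p) (posRat p.2) 0 + rat (listWeight q l) := by
  cases h : q p <;> simp [listWeight, h, rat_ratAdd, rat_ratOfPosRat]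

theorem rat_listWeight_nonneg (q : ℕ × ℕ → Bool) (l : List (ℕ × ℕ)) :
    0 ≤ rat (listWeight q l) := by
  induction l with
  | nil => exact rat_zero.ge
  | cons p l ih =>
    rw [rat_listWeight_cons]
    refine add_nonneg ?_ ih
    cases q p
    · exact le_rfl
    · exact (posRat_pos _).le

theorem primrec_listWeight {α : Type*} [Primcodable α] {q : α → ℕ × ℕ → Bool} (hq : Primrec₂ q)
    {l : α → List (ℕ × ℕ)} (hl : Primrec l) : Primrec fun a => listWeight (q a) (l a) :=
  Primrec.list_foldr (h := fun a (x : (ℕ × ℕ) × ℕ) =>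
      cond (q a x.1) (ratAdd (ratOfPosRat x.1.2) x.2) x.2) hl (Primrec.const 0)
    (Primrec.cond (hq.comp Primrec.fst (Primrec.fst.comp Primrec.snd))
      (primrec_ratAdd.comp
        (primrec_ratOfPosRat.comp (Primrec.snd.comp (Primrec.fst.comp Primrec.snd)))
        (Primrec.snd.comp Primrec.snd))
      (Primrec.snd.comp Primrec.snd))

/-- The points lying in one of the given ideal balls with a margin larger than `δ`. -/
def marginSet (X : Type*) [MetricSpace X] [ComputableMetricSpace X] (W : ℕ × ℕ → Prop) (δ : ℝ) :
    Set X :=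
  {x | ∃ c, W c ∧ dist x (ComputableMetricSpace.ideal c.1) + δ < ((posRat c.2 : ℚ) : ℝ)}

theorem isOpen_marginSet (W : ℕ × ℕ → Prop) (δ : ℝ) : IsOpen (marginSet X W δ) := by
  have h : marginSet X W δ = ⋃ c, ⋃ _ : W c,
      {x | dist x (ComputableMetricSpace.ideal c.1) + δ < ((posRat c.2 : ℚ) : ℝ)} := by
    ext x; simp [marginSet]
  rw [h]
  exact isOpen_iUnion fun c => isOpen_iUnion fun _ =>
    isOpen_lt (by fun_prop) continuous_const

theorem marginSet_anti (W : ℕ × ℕ → Prop) {δ δ' : ℝ} (h : δ ≤ δ') :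
    marginSet X W δ' ⊆ marginSet X W δ := fun _ ⟨c, hc, hx⟩ => ⟨c, hc, by linarith⟩

/-- Spare margin absorbs the thickening in the Prokhorov inequalities. -/
theorem thickening_marginSet_subset (W : ℕ × ℕ → Prop) (δ δ' : ℝ) :
    Metric.thickening δ (marginSet X W (δ' + δ)) ⊆ marginSet X W δ' := by
  intro x hx
  obtain ⟨z, ⟨c, hc, hz⟩, hxz⟩ := Metric.mem_thickening_iff.1 hx
  have := dist_triangle x z (ComputableMetricSpace.ideal c.1)
  exact ⟨c, hc, by linarith⟩

theorem iUnion_marginSet_half_pow (W : ℕ × ℕ → Prop) :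
    ⋃ m : ℕ, marginSet X W ((2⁻¹ : ℝ) ^ m + (2⁻¹ : ℝ) ^ m) = marginSet X W 0 := by
  refine Set.Subset.antisymm (Set.iUnion_subset fun m => marginSet_anti W (by positivity)) ?_
  rintro x ⟨c, hc, hx⟩
  obtain ⟨m, hm⟩ := exists_halfPow_lt (half_pos (sub_pos.2 hx))
  exact Set.mem_iUnion.2 ⟨m, c, hc, by linarith⟩

variable [MeasurableSpace X]

theorem idealMeasure_cons (p : ℕ × ℕ) (l : List (ℕ × ℕ)) (B : Set X) :
    idealMeasure (X := X) (p :: l) B = ENNReal.ofReal ((posRat p.2 : ℚ) : ℝ) *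
      Measure.dirac (ComputableMetricSpace.ideal (X := X) p.1) B + idealMeasure l B := by
  simp [idealMeasure]

theorem ofReal_rat_listWeight_cons (q : ℕ × ℕ → Bool) (p : ℕ × ℕ) (l : List (ℕ × ℕ)) :
    ENNReal.ofReal ((rat (listWeight q (p :: l)) : ℚ) : ℝ) =
      ENNReal.ofReal ((cond (q p) (posRat p.2) 0 : ℚ) : ℝ) +
        ENNReal.ofReal ((rat (listWeight q l) : ℚ) : ℝ) := by
  rw [rat_listWeight_cons, Rat.cast_add, ENNReal.ofReal_add]
  · cases q p
    · simp
    · exact (posRat_cast_pos _).le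
  · exact_mod_cast rat_listWeight_nonneg q l

/-- At a finite stage `q` only underestimates membership in `B`, hence a one-sided bound; the
converse bound holds once the stage is late enough for the whole list. -/
theorem ofReal_listWeight_le_idealMeasure {q : ℕ × ℕ → Bool} {B : Set X} (hB : MeasurableSet B) :
    ∀ {l : List (ℕ × ℕ)}, (∀ p ∈ l, q p = true → ComputableMetricSpace.ideal (X := X) p.1 ∈ B) →
      ENNReal.ofReal ((rat (listWeight q l) : ℚ) : ℝ) ≤ idealMeasure l B := by
  intro l
  induction l with
  | nil => simp [listWeight, rat_zero]
  | cons p l ih =>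
    intro h
    rw [idealMeasure_cons, ofReal_rat_listWeight_cons]
    refine add_le_add ?_ (ih fun p' hp' => h p' (List.mem_cons_of_mem _ hp'))
    cases hq : q p with
    | false => simp
    | true => simp [Measure.dirac_apply' _ hB, h p List.mem_cons_self hq]

theorem idealMeasure_le_ofReal_listWeight {q : ℕ × ℕ → Bool} {B : Set X} (hB : MeasurableSet B) :
    ∀ {l : List (ℕ × ℕ)}, (∀ p ∈ l, ComputableMetricSpace.ideal (X := X) p.1 ∈ B → q p = true) →
      idealMeasure l B ≤ ENNReal.ofReal ((rat (listWeight q l) : ℚ) : ℝ) := by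
  intro l
  induction l with
  | nil => simp [idealMeasure]
  | cons p l ih =>
    intro h
    rw [idealMeasure_cons, ofReal_rat_listWeight_cons]
    refine add_le_add ?_ (ih fun p' hp' => h p' (List.mem_cons_of_mem _ hp'))
    rw [Measure.dirac_apply' _ hB]
    by_cases hp : ComputableMetricSpace.ideal (X := X) p.1 ∈ B
    · simp [hp, h p List.mem_cons_self hp]
    · simp [hp]

/-- The measure of constructive open sets is lower semicomputable, uniformly. -/
theorem IsComputableMeasure.rePred_lt_measure [BorelSpace X] {μ : Measure X}
    (hμ : IsComputableMeasure μ) {ι : Type*} [Primcodable ι] {U : ι → Set X}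
    (hU : UniformlyConstructiveOpen U) :
    REPred fun x : ι × ℕ => ENNReal.ofReal ((posRat x.2 : ℚ) : ℝ) < μ (U x.1) := by
  obtain ⟨A, hA, hAμ⟩ := hμ
  obtain ⟨W, hW, hUW⟩ := uniformlyConstructiveOpen_iff.1 hU
  have hU0 : ∀ i, U i = marginSet X (W i) 0 := fun i => Set.ext fun x => by
    rw [hUW]; simp [marginSet, idealBall]
  -- Ideal point `j` has margin larger than `2⁻ᵐ` in the family exactly when the ball of radius
  -- `2⁻ᵐ` about it is formally inside a member.
  have hS : REPred fun y : (ι × ℕ) × ℕ =>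
      ∃ c, W y.1.1 c ∧ FormallyInside X (y.2, halfPow y.1.2) c := by
    refine REPred.exists (p := fun (y : (ι × ℕ) × ℕ) c =>
      W y.1.1 c ∧ FormallyInside X (y.2, halfPow y.1.2) c) (REPred.and ?_ ?_)
    · exact REPred.comp (f := fun z : ((ι × ℕ) × ℕ) × (ℕ × ℕ) => (z.1.1.1, z.2)) hW
        ((Computable.fst.comp (Computable.fst.comp Computable.fst)).pair Computable.snd)
    · exact REPred.comp
        (f := fun z : ((ι × ℕ) × ℕ) × (ℕ × ℕ) => ((z.1.2, halfPow z.1.1.2), z.2))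
        (rePred_formallyInside X) (((Computable.snd.comp Computable.fst).pair
          (primrec_halfPow.to_comp.comp
            (Computable.snd.comp (Computable.fst.comp Computable.fst)))).pair Computable.snd)
  obtain ⟨q, hq, hqmono, hqS⟩ := hS.exists_primrec
  have hqE : ∀ i m j, (∃ t, q ((i, m), j) t = true) ↔
      ComputableMetricSpace.ideal (X := X) j ∈ marginSet X (W i) ((2⁻¹ : ℝ) ^ m) := by
    intro i m j
    rw [← hqS]
    simp only [FormallyInside, posRat_halfPow, marginSet, Set.mem_ofPred_eq]
  -- Stage `t` of the mass that the approximating measure gives to the set with margin `2⁻ᵐ`. The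
  -- index `m + 1` makes the Prokhorov distance strictly less than `2⁻ᵐ`.
  let w : (ι × ℕ) → ℕ → ℕ → ℕ := fun x m t =>
    listWeight (fun p => q ((x.1, m), p.1) t) (A (m + 1))
  have hw : Computable fun z : ((ι × ℕ) × ℕ) × ℕ => w z.1.1 z.1.2 z.2 := by
    have h1 : Primrec fun y : (((ι × ℕ) × ℕ) × ℕ) × List (ℕ × ℕ) =>
        listWeight (fun p => q ((y.1.1.1.1, y.1.1.2), p.1) y.1.2) y.2 := by
      refine primrec_listWeight (q := fun (y : (((ι × ℕ) × ℕ) × ℕ) × List (ℕ × ℕ)) p =>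
        q ((y.1.1.1.1, y.1.1.2), p.1) y.1.2) ?_ Primrec.snd
      have h2 : Primrec fun u : ((((ι × ℕ) × ℕ) × ℕ) × List (ℕ × ℕ)) × (ℕ × ℕ) => u.1.1 :=
        Primrec.fst.comp Primrec.fst
      have h3 := Primrec.fst.comp h2
      exact hq.comp (((Primrec.fst.comp (Primrec.fst.comp h3)).pair (Primrec.snd.comp h3)).pair
        (Primrec.fst.comp Primrec.snd)) (Primrec.snd.comp h2)
    have h4 : Computable fun z : ((ι × ℕ) × ℕ) × ℕ => A (z.1.2 + 1) :=
      hA.comp (Computable.succ.comp (Computable.snd.comp Computable.fst))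
    exact (Computable.comp h1.to_comp (Computable.id.pair h4)).of_eq fun z => rfl
  have hre : REPred fun x : ι × ℕ => ∃ m t,
      rat (ratAdd (ratOfPosRat x.2) (ratOfPosRat (halfPow m))) < rat (w x m t) := by
    refine REPred.exists (p := fun (x : ι × ℕ) m => ∃ t,
      rat (ratAdd (ratOfPosRat x.2) (ratOfPosRat (halfPow m))) < rat (w x m t)) ?_
    refine REPred.exists (p := fun (y : (ι × ℕ) × ℕ) t =>
      rat (ratAdd (ratOfPosRat y.1.2) (ratOfPosRat (halfPow y.2))) < rat (w y.1 y.2 t)) ?_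
    refine rePred_rat_lt (primrec_ratAdd.to_comp.comp
      (primrec_ratOfPosRat.to_comp.comp ?_) (primrec_ratOfPosRat.to_comp.comp
        (primrec_halfPow.to_comp.comp (Computable.snd.comp Computable.fst)))) hw
    exact Computable.snd.comp (Computable.fst.comp Computable.fst)
  have hcmp : ∀ e m n, rat (ratAdd (ratOfPosRat e) (ratOfPosRat (halfPow m))) < rat n ↔
      ((posRat e : ℚ) : ℝ) + (2⁻¹ : ℝ) ^ m < ((rat n : ℚ) : ℝ) := by
    intro e m n
    rw [← posRat_halfPow, rat_ratAdd, rat_ratOfPosRat, rat_ratOfPosRat, ← Rat.cast_add,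
      Rat.cast_lt]
  have hLP : ∀ m, levyProkhorovEDist (idealMeasure (X := X) (A (m + 1))) μ <
      ENNReal.ofReal ((2⁻¹ : ℝ) ^ m) := by
    intro m
    refine (hAμ (m + 1)).2.trans_lt ?_
    have h2 : (2⁻¹ : ℝ≥0∞) = ENNReal.ofReal (2⁻¹ : ℝ) := by
      rw [ENNReal.ofReal_inv_of_pos two_pos]; simp
    rw [h2, ← ENNReal.ofReal_pow (by norm_num)]
    refine (ENNReal.ofReal_lt_ofReal_iff (by positivity)).2 ?_
    exact pow_lt_pow_right_of_lt_one₀ (by norm_num) (by norm_num) (Nat.lt_succ_self m)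
  refine hre.of_eq ?_
  rintro ⟨i, e⟩
  simp only [hcmp]
  have he : (0 : ℝ) ≤ ((posRat e : ℚ) : ℝ) := (posRat_cast_pos e).le
  have hmeas : ∀ δ, MeasurableSet (marginSet X (W i) δ) := fun δ =>
    (isOpen_marginSet (W i) δ).measurableSet
  constructor
  · rintro ⟨m, t, h⟩
    have hδ : (0 : ℝ) ≤ (2⁻¹ : ℝ) ^ m := by positivity
    have h1 : ENNReal.ofReal ((rat (w (i, e) m t) : ℚ) : ℝ) ≤
        idealMeasure (A (m + 1)) (marginSet X (W i) ((2⁻¹ : ℝ) ^ m)) :=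
      ofReal_listWeight_le_idealMeasure (hmeas _) fun p _ hp => (hqE i m p.1).1 ⟨t, hp⟩
    have h2 := left_measure_le_of_levyProkhorovEDist_lt (hLP m) (hmeas ((2⁻¹ : ℝ) ^ m))
    rw [ENNReal.toReal_ofReal hδ] at h2
    have h3 : Metric.thickening ((2⁻¹ : ℝ) ^ m) (marginSet X (W i) ((2⁻¹ : ℝ) ^ m)) ⊆ U i := by
      have := thickening_marginSet_subset (X := X) (W i) ((2⁻¹ : ℝ) ^ m) 0
      rwa [zero_add, ← hU0] at this
    have h4 := (ENNReal.ofReal_lt_ofReal_iff_of_nonneg (add_nonneg he hδ)).2 h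
    rw [ENNReal.ofReal_add he hδ] at h4
    refine (ENNReal.add_lt_add_iff_right ENNReal.ofReal_ne_top).1 (h4.trans_le ?_)
    exact h1.trans (h2.trans (add_le_add_left (measure_mono h3) _))
  · intro h
    rw [hU0, ← iUnion_marginSet_half_pow] at h
    have hmono : Monotone fun m : ℕ => marginSet X (W i) ((2⁻¹ : ℝ) ^ m + (2⁻¹ : ℝ) ^ m) := by
      intro m n hmn
      have : (2⁻¹ : ℝ) ^ n ≤ (2⁻¹ : ℝ) ^ m :=
        pow_le_pow_of_le_one (by norm_num) (by norm_num) hmn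
      exact marginSet_anti _ (by linarith)
    have hpow : Tendsto (fun m : ℕ => (2⁻¹ : ℝ) ^ m) atTop (𝓝 0) :=
      tendsto_pow_atTop_nhds_zero_of_lt_one (by norm_num) (by norm_num)
    have hlim : Tendsto (fun m : ℕ => ENNReal.ofReal
        (((posRat e : ℚ) : ℝ) + ((2⁻¹ : ℝ) ^ m + (2⁻¹ : ℝ) ^ m))) atTop
        (𝓝 (ENNReal.ofReal ((posRat e : ℚ) : ℝ))) := by
      have := ENNReal.tendsto_ofReal
        ((hpow.add hpow).const_add (((posRat e : ℚ) : ℝ)))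
      simpa using this
    -- Two errors `2⁻ᵐ` are reserved: one is lost in passing from `μ` to the approximating measure,
    -- the other is demanded by the test. The double margin likewise leaves `2⁻ᵐ` after thickening.
    obtain ⟨m, hm⟩ := (hlim.eventually_lt (tendsto_measure_iUnion_atTop (μ := μ) hmono) h).exists
    have hδ : (0 : ℝ) ≤ (2⁻¹ : ℝ) ^ m := by positivity
    have h1 := right_measure_le_of_levyProkhorovEDist_lt (hLP m)
      (hmeas ((2⁻¹ : ℝ) ^ m + (2⁻¹ : ℝ) ^ m))
    rw [ENNReal.toReal_ofReal hδ] at h1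
    obtain ⟨t, ht⟩ : ∃ t, ∀ p ∈ {p | p ∈ A (m + 1)},
        ComputableMetricSpace.ideal (X := X) p.1 ∈ marginSet X (W i) ((2⁻¹ : ℝ) ^ m) →
          q ((i, m), p.1) t = true := by
      refine ((eventually_all_finite (l := atTop) (List.finite_toSet (A (m + 1)))).2
        fun p _ => ?_).exists
      by_cases hp : ComputableMetricSpace.ideal (X := X) p.1 ∈ marginSet X (W i) ((2⁻¹ : ℝ) ^ m)
      · obtain ⟨s, hs⟩ := (hqE i m p.1).2 hp
        exact (eventually_ge_atTop s).mono fun t hst _ => hqmono _ _ _ hst hs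
      · exact Eventually.of_forall fun t h => absurd h hp
    have h2 : idealMeasure (A (m + 1)) (marginSet X (W i) ((2⁻¹ : ℝ) ^ m)) ≤
        ENNReal.ofReal ((rat (w (i, e) m t) : ℚ) : ℝ) :=
      idealMeasure_le_ofReal_listWeight (hmeas _) ht
    refine ⟨m, t, ?_⟩
    have h3 : idealMeasure (A (m + 1)) (Metric.thickening ((2⁻¹ : ℝ) ^ m)
        (marginSet X (W i) ((2⁻¹ : ℝ) ^ m + (2⁻¹ : ℝ) ^ m))) ≤
        ENNReal.ofReal ((rat (w (i, e) m t) : ℚ) : ℝ) :=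
      (measure_mono (thickening_marginSet_subset _ _ _)).trans h2
    have h4 := hm.trans_le (h1.trans (add_le_add_left h3 _))
    have hw0 : (0 : ℝ) ≤ ((rat (w (i, e) m t) : ℚ) : ℝ) := by
      exact_mod_cast rat_listWeight_nonneg _ _
    rw [← ENNReal.ofReal_add hw0 hδ,
      ENNReal.ofReal_lt_ofReal_iff_of_nonneg (by positivity)] at h4
    linarith

end LowerSemicomputability

/-! ### Computable points in Borel–Cantelli sets. -/

section ComputablePoints

variable {X : Type*} [MetricSpace X] [ComputableMetricSpace X]

/-- A nested sequence of ideal balls with radii tending to `0` shrinks to a point. -/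
theorem exists_mem_idealBall_of_formallyInside [CompleteSpace X] {s : ℕ → ℕ × ℕ}
    (hs : ∀ n, FormallyInside X (s (n + 1)) (s n))
    (hr : Tendsto (fun n => ((posRat (s n).2 : ℚ) : ℝ)) atTop (𝓝 0)) :
    ∃ x : X, ∀ n, x ∈ idealBall X (s n) := by
  have hle : ∀ n m, n ≤ m → dist (ComputableMetricSpace.ideal (X := X) (s n).1)
      (ComputableMetricSpace.ideal (s m).1) + ((posRat (s m).2 : ℚ) : ℝ) ≤
        ((posRat (s n).2 : ℚ) : ℝ) := by
    intro n m hnm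
    induction m, hnm using Nat.le_induction with
    | base => simp
    | succ m hm ih =>
      have h1 := hs m
      unfold FormallyInside at h1
      have h2 := dist_triangle_right (ComputableMetricSpace.ideal (X := X) (s n).1)
        (ComputableMetricSpace.ideal (s (m + 1)).1) (ComputableMetricSpace.ideal (s m).1)
      linarith
  have hdist : ∀ n m, n ≤ m → dist (ComputableMetricSpace.ideal (X := X) (s n).1)
      (ComputableMetricSpace.ideal (s m).1) ≤ ((posRat (s n).2 : ℚ) : ℝ) := fun n m hnm => by
    linarith [hle n m hnm, posRat_cast_pos (s m).2]
  obtain ⟨x, hx⟩ := cauchySeq_tendsto_of_complete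
    (cauchySeq_of_le_tendsto_0' (s := fun n => ComputableMetricSpace.ideal (X := X) (s n).1)
      _ hdist hr)
  refine ⟨x, fun n => (hs n).mem_of_dist_le ?_⟩
  refine le_of_tendsto (tendsto_const_nhds.dist hx) ?_
  filter_upwards [eventually_ge_atTop (n + 1)] with m hm using hdist _ _ hm

variable [MeasurableSpace X]

/-- An effective nested-ball construction, with positive measure of ball ∩ `G` as the invariant that
keeps the search alive. -/
theorem IsBorelCantelliSet.support_subset_closure [BorelSpace X] [CompleteSpace X]
    {μ : Measure X} (hμ : IsComputableMeasure μ) {R : Set X} (hR : IsBorelCantelliSet μ R) :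
    μ.support ⊆ closure {x | x ∈ μ.support ∧ IsComputablePoint x ∧ x ∈ R} := by
  obtain ⟨U, ⟨hU, A, hA, hAU⟩, rfl⟩ := hR
  intro y hy
  rw [Metric.mem_closure_iff]
  intro ε hε
  obtain ⟨b₀, hyb₀, hb₀⟩ := exists_mem_idealBall_radius_lt y (half_pos hε)
  have hμb₀ : 0 < μ (idealBall X b₀) :=
    (Measure.mem_support_iff_forall y).1 hy _ ((isOpen_idealBall b₀).mem_nhds hyb₀)
  obtain ⟨e₀, he₀⟩ := exists_posRat_lt hμb₀
  let k := A e₀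
  let G : Set X := ⋂ n, U (k + n)
  let P : ℕ × ℕ → Prop := fun b => 0 < μ (idealBall X b ∩ G)
  -- Soundness of the finite test for `P`: beyond index `A e` the sets remove at most `posRat e`. If
  -- `A e ≤ k`, nothing has to be tested.
  have htail : ∀ (e : ℕ) (B : Set X), ENNReal.ofReal ((posRat e : ℚ) : ℝ) < μ B →
      ∀ b, (∀ x ∈ B, x ∈ idealBall X b ∧ ∀ n < A e - k, x ∈ U (k + n)) → P b := by
    intro e B hB b hBb
    have hsub : B ⊆ (idealBall X b ∩ G) ∪ ⋃ j, (U (A e + j))ᶜ := by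
      intro x hx
      by_cases hG : x ∈ G
      · exact Or.inl ⟨(hBb x hx).1, hG⟩
      · obtain ⟨n, hn⟩ : ∃ n, x ∉ U (k + n) := by simpa [G] using hG
        have hle : A e ≤ k + n := by
          by_contra hlt
          exact hn ((hBb x hx).2 n (by omega))
        refine Or.inr (Set.mem_iUnion.2 ⟨k + n - A e, ?_⟩)
        rwa [Nat.add_sub_cancel' hle]
    by_contra h0
    have h0' : μ (idealBall X b ∩ G) = 0 := by simpa [P] using h0
    refine hB.not_ge ((measure_mono hsub).trans ((measure_union_le _ _).trans ?_))
    rw [h0', zero_add]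
    exact (measure_iUnion_le _).trans (hAU e)
  -- Since `k = A e₀`, the finite intersection is vacuous and the measure of the ball alone
  -- suffices.
  have hPb₀ : P b₀ := htail e₀ _ he₀ b₀ fun x hx => ⟨hx, fun n hn => by simp [k] at hn⟩
  have hPre : REPred P := by
    have hopen : UniformlyConstructiveOpen fun x : (ℕ × ℕ) × ℕ =>
        idealBall X x.1 ∩ ⋂ n < A x.2 - k, U (k + n) := by
      refine UniformlyConstructiveOpen.inter
        (uniformlyConstructiveOpen_idealBall.comp Computable.fst) ?_
      refine UniformlyConstructiveOpen.iInter_lt (U := fun (_ : (ℕ × ℕ) × ℕ) n => U (k + n))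
        (hU.comp (Primrec.nat_add.to_comp.comp (Computable.const k) Computable.snd)) ?_
      exact Primrec.nat_sub.to_comp.comp (hA.comp Computable.snd) (Computable.const k)
    have hlt := REPred.comp
      (f := fun x : (ℕ × ℕ) × ℕ => (x, x.2)) (hμ.rePred_lt_measure hopen)
      (Computable.id.pair Computable.snd)
    refine (REPred.exists (p := fun (b : ℕ × ℕ) e => ENNReal.ofReal ((posRat e : ℚ) : ℝ) <
      μ (idealBall X b ∩ ⋂ n < A e - k, U (k + n))) hlt).of_eq fun b => ⟨?_, fun hb => ?_⟩
    · rintro ⟨e, he⟩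
      exact htail e _ he b fun x hx => ⟨hx.1, Set.mem_iInter₂.1 hx.2⟩
    · obtain ⟨e, he⟩ := exists_posRat_lt hb
      refine ⟨e, he.trans_le (measure_mono (Set.inter_subset_inter_right _ ?_))⟩
      exact fun x hx => Set.mem_iInter₂.2 fun n _ => Set.mem_iInter.1 hx n
  obtain ⟨W, hW, hUW⟩ := uniformlyConstructiveOpen_iff.1 hU
  let S : ℕ → ℕ × ℕ → ℕ × ℕ → Prop := fun n b b' =>
    (rat (ratOfPosRat b'.2) < rat (ratOfPosRat (halfPow n)) ∧ FormallyInside X b' b) ∧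
      (∃ c, W (k + n) c ∧ FormallyInside X b' c) ∧ P b'
  have hSre : REPred fun x : (ℕ × ℕ × ℕ) × ℕ × ℕ => S x.1.1 x.1.2 x.2 := by
    refine REPred.and (REPred.and ?_ ?_) (REPred.and ?_ (hPre.comp Computable.snd))
    · exact rePred_rat_lt (primrec_ratOfPosRat.to_comp.comp (Computable.snd.comp Computable.snd))
        (primrec_ratOfPosRat.to_comp.comp (primrec_halfPow.to_comp.comp
          (Computable.fst.comp Computable.fst)))
    · exact REPred.comp (f := fun x : (ℕ × ℕ × ℕ) × ℕ × ℕ => (x.2, x.1.2))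
        (rePred_formallyInside X) (Computable.snd.pair (Computable.snd.comp Computable.fst))
    · refine REPred.exists (p := fun (x : (ℕ × ℕ × ℕ) × ℕ × ℕ) c =>
        W (k + x.1.1) c ∧ FormallyInside X x.2 c) (REPred.and ?_ ?_)
      · exact REPred.comp (f := fun z : ((ℕ × ℕ × ℕ) × ℕ × ℕ) × ℕ × ℕ => (k + z.1.1.1, z.2)) hW
          ((Primrec.nat_add.to_comp.comp (Computable.const k)
            (Computable.fst.comp (Computable.fst.comp Computable.fst))).pair Computable.snd)
      · exact REPred.comp (f := fun z : ((ℕ × ℕ × ℕ) × ℕ × ℕ) × ℕ × ℕ => (z.1.2, z.2))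
          (rePred_formallyInside X) ((Computable.snd.comp Computable.fst).pair Computable.snd)
  have hrad : ∀ b n, rat (ratOfPosRat b) < rat (ratOfPosRat (halfPow n)) ↔
      ((posRat b : ℚ) : ℝ) < (2⁻¹ : ℝ) ^ n := fun b n => by
    rw [rat_ratOfPosRat, rat_ratOfPosRat, ← posRat_halfPow, Rat.cast_lt]
  have hnext : ∀ n b, P b → ∃ b', S n b b' := by
    intro n b hb
    by_contra! hno
    -- Otherwise each point of `b ∩ G` would lie in a small ideal ball meeting `G` in a null set;
    -- there are countably many such balls, so `b ∩ G` would be null.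
    refine hb.ne' (measure_mono_null (t := ⋃ b' ∈ {b' | μ (idealBall X b' ∩ G) = 0},
      idealBall X b' ∩ G) ?_ ((measure_biUnion_null_iff (Set.to_countable _)).2 fun b' h => h))
    rintro x ⟨hxb, hxG⟩
    obtain ⟨c, hc, hxc⟩ := (hUW (k + n) x).1 (Set.mem_iInter.1 hxG n)
    obtain ⟨δ, ⟨⟨hδb, hδc⟩, hδn⟩, hδ0⟩ := (((eventually_formallyInside hxb).and
      (eventually_formallyInside hxc)).and (Ioo_mem_nhdsGT
        (show (0 : ℝ) < (2⁻¹ : ℝ) ^ n by positivity)) |>.and self_mem_nhdsWithin).exists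
    obtain ⟨b', hxb', hb'⟩ := exists_mem_idealBall_radius_lt x (Set.mem_Ioi.1 hδ0)
    refine Set.mem_biUnion (x := b') ?_ ⟨hxb', hxG⟩
    by_contra hpos
    exact hno b' ⟨⟨(hrad _ _).2 (hb'.trans hδn.2), hδb b' hxb' hb'⟩, ⟨c, hc, hδc b' hxb' hb'⟩,
      pos_iff_ne_zero.2 hpos⟩
  obtain ⟨s, hs, hs0, hsS⟩ := REPred.exists_computable_seq hSre hnext
    (fun n b b' h => h.2.2) hPb₀
  have hsP : ∀ n, P (s n)
    | 0 => hs0 ▸ hPb₀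
    | n + 1 => (hsS n).2.2
  have hsr : ∀ n, ((posRat (s (n + 1)).2 : ℚ) : ℝ) < (2⁻¹ : ℝ) ^ n := fun n =>
    (hrad _ _).1 (hsS n).1.1
  have hlim : Tendsto (fun n => ((posRat (s n).2 : ℚ) : ℝ)) atTop (𝓝 0) := by
    rw [← tendsto_add_atTop_iff_nat 1]
    exact squeeze_zero (fun n => (posRat_cast_pos _).le) (fun n => (hsr n).le)
      (tendsto_pow_atTop_nhds_zero_of_lt_one (by norm_num) (by norm_num))
  obtain ⟨x, hx⟩ := exists_mem_idealBall_of_formallyInside (fun n => (hsS n).1.2) hlim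
  refine ⟨x, ⟨?_, ?_, ?_⟩, ?_⟩
  -- The balls `s n` have positive measure and shrink to `x`, so every neighbourhood of `x` contains
  -- one.
  · rw [Measure.mem_support_iff_forall]
    intro O hO
    obtain ⟨η, hη, hηO⟩ := Metric.mem_nhds_iff.1 hO
    obtain ⟨n, hn⟩ := (hlim.eventually (gt_mem_nhds (half_pos hη))).exists
    refine (hsP n).trans_le (measure_mono fun z hz => hηO ?_)
    have h1 := Metric.mem_ball.1 hz.1
    have h2 := Metric.mem_ball.1 (hx n)
    have := dist_triangle_right z x (ComputableMetricSpace.ideal (X := X) (s n).1)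
    rw [Metric.mem_ball]
    linarith
  -- The shift skips `b₀`, whose radius is not bounded by the construction.
  · refine ⟨fun n => (s (n + 1)).1, Computable.fst.comp (hs.comp Computable.succ), fun n => ?_⟩
    exact ((Metric.mem_ball'.1 (hx (n + 1))).trans (hsr n)).le
  · refine Set.mem_iUnion.2 ⟨k, Set.mem_iInter₂.2 fun n hn => ?_⟩
    obtain ⟨j, rfl⟩ := Nat.exists_eq_add_of_le hn
    obtain ⟨c, hc, hsc⟩ := (hsS j).2.1
    exact (hUW _ x).2 ⟨c, hc, hsc.subset (hx (j + 1))⟩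
  · have h1 := Metric.mem_ball.1 hyb₀
    have h2 := Metric.mem_ball.1 (hs0 ▸ hx 0)
    have := dist_triangle_right y x (ComputableMetricSpace.ideal (X := X) b₀.1)
    linarith

end ComputablePoints

end ConstructiveBC

theorem mainTheorem5 {X : Type*} [MetricSpace X] [ComputableMetricSpace X]
    [MeasurableSpace X] [BorelSpace X]
    (μ : Measure X) [IsProbabilityMeasure μ] (hμ : IsComputableMeasure μ)
    (f : ℕ → X → ℝ) (g : X → ℝ)
    (hf_meas : ∀ n, Measurable (f n)) (hg_meas : Measurable g)
    (hf : UniformlyAEComputable μ f) (hg : UniformlyAEComputable μ (fun _ : Unit => g))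
    (hconv : EffectivelyAlmostSurely μ f g) :
    (∃ R : Set X, IsBorelCantelliSet μ R ∧
      R ⊆ {x | Tendsto (fun n => f n x) atTop (𝓝 (g x))}) ∧
    (CompleteSpace X →
      μ.support ⊆ closure {x | x ∈ μ.support ∧ IsComputablePoint x ∧
        Tendsto (fun n => f n x) atTop (𝓝 (g x))}) := by
  obtain ⟨R, hR, hRconv⟩ := hconv.exists_isBorelCantelliSet hf hg
  refine ⟨⟨R, hR, hRconv⟩, fun _ => (hR.support_subset_closure hμ).trans (closure_mono ?_)⟩
  exact fun x hx => ⟨hx.1, hx.2.1, hRconv hx.2.2⟩
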